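/- **Setting.** All processes are real-valued and defined on one probability space. An *additive process* is a process $\{X_t\}_{t\ge 0}$ with $X_0=0$ a.s. that has independent increments, is stochastically continuous, and whose sample paths are (almost surely) right-continuous in $t\ge 0$ with left limits in $t>0$. A *Lévy process* is an additive process with stationary increments. A process $\{X_t\}_{t\ge0}$ is called *recurrent* if for every $s\ge 0$, $\liminf_{t\to\infty}|X_t-X_s|=0$ a.s., and *transient* if $\lim_{t\to\infty}|X_t|=\infty$ a.s. Let $\{Y_t\}_{t\ge 0}$ and $\{Z_t\}_{t\ge 0}$ be two independent Lévy processes on $\mathbb{R}$, let $0<q<p$, and let $\{X_t\}_{t\ge 0}$ be the process defined a.s. by $X_0=0$ and, for $n=0,1,2,\dots$, $$ X_t=\begin{cases} X_{np}+Y_t-Y_{np} & (np<t\le np+q),\\ X_{np+q}+Z_t-Z_{np+q} & (np+q<t\le (n+1)p).\end{cases} $$ **Corollary 4.3.** Assume $E[|Y_1|]<\infty$ and $E[|Z_1|]<\infty$. Then $Y_q$ and $Z_{p-q}$ are integrable, and the following hold. (i) $\{Y_t\}$ and $\{Z_t\}$ are both recurrent if and only if $E[Y_1]=E[Z_1]=0$;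 this implies $E[Y_q+Z_{p-q}]=0$; and $E[Y_q+Z_{p-q}]=0$ if and only if $\{X_t\}$ is recurrent. In particular, if $\{Y_t\}$ and $\{Z_t\}$ are recurrent, then $\{X_t\}$ is recurrent. (ii) $\{Y_t\}$ is recurrent and $\{Z_t\}$ is transient if and only if $E[Y_1]=0$ and $E[Z_1]\neq 0$; this implies $E[Y_q+Z_{p-q}]\ne 0$; and $E[Y_q+Z_{p-q}]\neq 0$ if and only if $\{X_t\}$ is transient. In particular, if $\{Y_t\}$ is recurrent and $\{Z_t\}$ is transient, then $\{X_t\}$ is transient. (iii) If $\{Y_t\}$ and $\{Z_t\}$ are both transient, then $\{X_t\}$ is recurrent if and only if $E[Y_q]=-E[Z_{p-q}]$, and it is transient if and only if $E[Y_q]\neq -E[Z_{p-q}]$. -/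

import Mathlib

open MeasureTheory ProbabilityTheory Filter Topology
open scoped NNReal

/-- An additive process `(X_t)_{t ≥ 0}`: it starts at `0` a.s., has independent increments, is
stochastically continuous, and almost surely its sample paths are right-continuous on `[0, ∞)`
and have left limits (in the state space) on `(0, ∞)`. -/
structure IsAdditiveProcess {Ω E : Type*} [MeasurableSpace Ω] [NormedAddCommGroup E]
    [MeasurableSpace E] (X : ℝ≥0 → Ω → E) (P : Measure Ω) : Prop where
  measurable : ∀ t, Measurable (X t)
  start_zero : ∀ᵐ ω ∂P, X 0 ω = 0
  indepIncrements : HasIndepIncrements X P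
  stochContinuous : ∀ t, TendstoInMeasure P X (𝓝 t) (X t)
  cadlag : ∀ᵐ ω ∂P,
    (∀ t, ContinuousWithinAt (fun s => X s ω) (Set.Ioi t) t) ∧
    (∀ t, 0 < t → ∃ l : E, Tendsto (fun s => X s ω) (𝓝[<] t) (𝓝 l))

/-- A Lévy process: an additive process with stationary increments. -/
structure IsLevyProcess {Ω E : Type*} [MeasurableSpace Ω] [NormedAddCommGroup E]
    [MeasurableSpace E] (X : ℝ≥0 → Ω → E) (P : Measure Ω) : Prop
    extends IsAdditiveProcess X P where
  stationaryIncrements : ∀ s t h : ℝ≥0,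
    IdentDistrib (fun ω => X (s + h) ω - X s ω) (fun ω => X (t + h) ω - X t ω) P P

/-- `s`-recurrence: `liminf_{t → ∞} |X_t - X_s| = 0` a.s. The `liminf` is taken in `[0, ∞]`, so
that it is the genuine one also along paths that escape to infinity. -/
def IsRecurrentFrom {Ω E : Type*} [MeasurableSpace Ω] [NormedAddCommGroup E]
    (s : ℝ≥0) (X : ℝ≥0 → Ω → E) (P : Measure Ω) : Prop :=
  ∀ᵐ ω ∂P, liminf (fun t : ℝ≥0 => ‖X t ω - X s ω‖ₑ) atTop = 0

/-- Recurrence: `s`-recurrence for every `s ≥ 0`. -/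
def IsRecurrentProcess {Ω E : Type*} [MeasurableSpace Ω] [NormedAddCommGroup E]
    (X : ℝ≥0 → Ω → E) (P : Measure Ω) : Prop :=
  ∀ s : ℝ≥0, IsRecurrentFrom s X P

/-- Transience: `lim_{t → ∞} |X_t| = ∞` a.s. -/
def IsTransientProcess {Ω E : Type*} [MeasurableSpace Ω] [NormedAddCommGroup E]
    (X : ℝ≥0 → Ω → E) (P : Measure Ω) : Prop :=
  ∀ᵐ ω ∂P, Tendsto (fun t : ℝ≥0 => ‖X t ω‖) atTop atTop

/-- `X` is the process that starts at `0` and follows alternately the increments of `Y` (on the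
time intervals `(np, np+q]`) and those of `Z` (on the time intervals `(np+q, (n+1)p]`). -/
def IsAlternatingProcess {Ω E : Type*} [MeasurableSpace Ω] [NormedAddCommGroup E]
    (p q : ℝ≥0) (Y Z X : ℝ≥0 → Ω → E) (P : Measure Ω) : Prop :=
  ∀ᵐ ω ∂P, X 0 ω = 0 ∧ ∀ (n : ℕ) (t : ℝ≥0),
    (n * p < t → t ≤ n * p + q →
      X t ω = X (n * p) ω + Y t ω - Y (n * p) ω) ∧
    (n * p + q < t → t ≤ (n + 1) * p →
      X t ω = X (n * p + q) ω + Z t ω - Z (n * p + q) ω)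

/-! Everything is decided by the drift per period, m = E[Y_q] + E[Z_{p-q}]. Almost surely X_t / t →
m / p (`IsAlternatingProcess.tendsto_div`), and E[Y_t] = t E[Y_1] gives m = q E[Y_1] + (p - q)
E[Z_1]. If m ≠ 0, then |X_t| → ∞. If m = 0, the increments of X over whole periods after a time s
form a stationary sequence with sublinear partial sums, and such sums return near 0 infinitely often
(`ae_frequently_abs_sum_lt`): a sublinear sequence has room for only o(N) times before N from which
it escapes its ε-neighbourhood for good, whereas by stationarity their expected number is N times
the escape probability. A transient path cannot be recurrent, so both criteria are equivalences
(`recurrent_iff_and_transient_iff`). The same argument with unit period treats Y and Z.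

The law of large numbers in continuous time follows from the discrete one: Ottaviani's inequality
and Borel–Cantelli show that the oscillation after the n-th multiple of a small δ is o(n). -/

/-! ### Recurrence of sublinear stationary sums -/

/-- If the points `s k`, `k ∈ F`, are `ε`-separated as soon as their indices are at least `K` apart,
then a bounded range leaves room for few of them. -/
theorem card_le_of_separated {s : ℕ → ℝ} {ε M : ℝ} {K : ℕ} (hε : 0 < ε) (hM : 0 ≤ M) (hK : 0 < K)
    (F : Finset ℕ) (hF : ∀ k ∈ F, ∀ l ∈ F, k + K ≤ l → ε ≤ |s l - s k|)
    (hsM : ∀ k ∈ F, |s k| ≤ M) : (F.card : ℝ) ≤ K * (2 * (M / ε) + 2) := by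
  -- Pigeonhole: distinct indices of `F` with the same residue mod `K` are at least `K` apart, so
  -- their values lie in different cells of length `ε`. Hence the pair (residue, cell) is injective
  -- on `F`.
  set T : Finset (ℕ × ℤ) := Finset.range K ×ˢ Finset.Icc ⌊-(M / ε)⌋ ⌊M / ε⌋ with hT
  have key : ∀ k ∈ F, ∀ l ∈ F, k < l → k % K = l % K → ⌊s k / ε⌋ ≠ ⌊s l / ε⌋ := by
    intro k hk l hl hkl hmod hfl
    have h1 : k + K ≤ l := by
      have h2 : K ∣ l - k := (Nat.modEq_iff_dvd' hkl.le).1 hmod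
      have := Nat.le_of_dvd (by omega) h2
      omega
    have h3 := Int.abs_sub_lt_one_of_floor_eq_floor hfl.symm
    rw [← sub_div, abs_div, abs_of_pos hε, div_lt_one hε] at h3
    exact absurd (hF k hk l hl h1) (not_le.2 h3)
  have hcard : F.card ≤ T.card := by
    refine Finset.card_le_card_of_injOn (fun k => (k % K, ⌊s k / ε⌋)) ?_ ?_
    · intro k hk
      have h := abs_le.1 (hsM k hk)
      simp only [hT, Finset.coe_product, Set.mem_prod, Finset.mem_coe, Finset.mem_range,
        Finset.mem_Icc]
      refine ⟨Nat.mod_lt _ hK, Int.floor_le_floor ?_, Int.floor_le_floor ?_⟩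
      · rw [← neg_div]; gcongr; exact h.1
      · gcongr; exact h.2
    · intro k hk l hl hkl
      simp only [Prod.mk.injEq] at hkl
      rcases lt_trichotomy k l with h | h | h
      · exact absurd hkl.2 (key k hk l hl h hkl.1)
      · exact h
      · exact absurd hkl.2.symm (key l hl k hk h hkl.1.symm)
  have hMε : 0 ≤ M / ε := by positivity
  have hTc : (T.card : ℝ) ≤ K * (2 * (M / ε) + 2) := by
    rw [hT, Finset.card_product, Finset.card_range, Int.card_Icc, Nat.cast_mul]
    gcongr
    have h0 : ⌊-(M / ε)⌋ ≤ ⌊M / ε⌋ := Int.floor_le_floor (by linarith)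
    have h1 : (((⌊M / ε⌋ + 1 - ⌊-(M / ε)⌋).toNat : ℤ) : ℝ) = ⌊M / ε⌋ + 1 - ⌊-(M / ε)⌋ := by
      rw [Int.toNat_of_nonneg (by omega)]; push_cast; ring
    rw [← Int.cast_natCast, h1]
    linarith [Int.floor_le (M / ε), Int.lt_floor_add_one (-(M / ε))]
  exact (Nat.cast_le.2 hcard).trans hTc

open Classical in
/-- A sequence of sublinear growth rarely leaves the `ε`-neighbourhood of its position for good. -/
theorem tendsto_card_escape_div {s : ℕ → ℝ} (hs : Tendsto (fun n : ℕ => s n / n) atTop (𝓝 0))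
    {ε : ℝ} (hε : 0 < ε) {K : ℕ} (hK : 0 < K) :
    Tendsto (fun N : ℕ => (((Finset.range N).filter
      fun k => ∀ n, K ≤ n → ε ≤ |s (k + n) - s k|).card : ℝ) / N) atTop (𝓝 0) := by
  have hK' : (0 : ℝ) < K := by exact_mod_cast hK
  have growth : ∀ η > 0, ∃ C, 0 ≤ C ∧ ∀ k : ℕ, |s k| ≤ C + η * k := by
    intro η hη
    obtain ⟨m, hm⟩ := (Metric.tendsto_atTop.1 hs) η hη
    refine ⟨∑ i ∈ Finset.range (m + 1), |s i|, Finset.sum_nonneg fun _ _ => abs_nonneg _, fun k => ?_⟩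
    have hC : 0 ≤ ∑ i ∈ Finset.range (m + 1), |s i| := Finset.sum_nonneg fun _ _ => abs_nonneg _
    by_cases hk : k ≤ m
    · have := Finset.single_le_sum (f := fun i => |s i|) (fun _ _ => abs_nonneg _)
        (Finset.mem_range.2 (Nat.lt_succ_of_le hk))
      have h2 : 0 ≤ η * k := by positivity
      linarith
    · push Not at hk
      have h1 := hm k hk.le
      have hk0 : (0 : ℝ) < k := by exact_mod_cast (Nat.zero_le m).trans_lt hk
      rw [Real.dist_eq, sub_zero, abs_div, abs_of_pos hk0, div_lt_iff₀ hk0] at h1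
      linarith
  rw [Metric.tendsto_atTop]
  intro ρ hρ
  -- This slope makes the part of the counting bound that is linear in `N` equal to `ρ / 2 * N`; the
  -- constant part falls below `ρ / 2 * N` past `N₀`.
  obtain ⟨C, hC0, hC⟩ := growth (ε * ρ / (4 * K)) (by positivity)
  obtain ⟨N₀, hN₀⟩ := exists_nat_gt (K * (2 * (C / ε) + 2) / (ρ / 2))
  refine ⟨N₀ + 1, fun N hN => ?_⟩
  have hN0 : (0 : ℝ) < N := by exact_mod_cast (by omega : 0 < N)
  rw [Real.dist_eq, sub_zero, abs_of_nonneg (by positivity), div_lt_iff₀ hN0]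
  have hcard := card_le_of_separated (s := s) (M := C + ε * ρ / (4 * K) * N) hε (by positivity) hK
    ((Finset.range N).filter fun k => ∀ n, K ≤ n → ε ≤ |s (k + n) - s k|)
    (by
      intro k hk l _ hkl
      have := (Finset.mem_filter.1 hk).2 (l - k) (by omega)
      rwa [Nat.add_sub_cancel' (by omega)] at this)
    (by
      intro k hk
      have hkN : (k : ℝ) ≤ N := by
        exact_mod_cast (Finset.mem_range.1 (Finset.mem_filter.1 hk).1).le
      exact (hC k).trans (by gcongr))
  refine hcard.trans_lt ?_
  have h1 : (K : ℝ) * (2 * (C / ε) + 2) < ρ / 2 * N := by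
    rw [div_lt_iff₀ (by positivity)] at hN₀
    have : (N₀ : ℝ) ≤ N := by exact_mod_cast (by omega : N₀ ≤ N)
    nlinarith
  have h2 : (K : ℝ) * (2 * ((C + ε * ρ / (4 * K) * N) / ε) + 2)
      = K * (2 * (C / ε) + 2) + ρ / 2 * N := by
    field_simp
    ring
  rw [h2]
  linarith

/-- Partial sums of a stationary sequence that grow sublinearly return to every neighbourhood of
the origin infinitely often. -/
theorem ae_frequently_abs_sum_lt {Ω : Type*} [MeasurableSpace Ω] {P : Measure Ω}
    [IsProbabilityMeasure P] {ξ : ℕ → Ω → ℝ} (hm : ∀ i, Measurable (ξ i))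
    (hstat : ∀ k, IdentDistrib (fun ω i => ξ (i + k) ω) (fun ω i => ξ i ω) P P)
    (hlim : ∀ᵐ ω ∂P, Tendsto (fun n : ℕ => (∑ i ∈ Finset.range n, ξ i ω) / n) atTop (𝓝 0))
    {ε : ℝ} (hε : 0 < ε) :
    ∀ᵐ ω ∂P, ∃ᶠ n in atTop, |∑ i ∈ Finset.range n, ξ i ω| < ε := by
  classical
  set S : ℕ → Ω → ℝ := fun n ω => ∑ i ∈ Finset.range n, ξ i ω with hS
  have hSm : ∀ n, Measurable (S n) := fun n => Finset.measurable_sum _ fun i _ => hm i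
  -- Escape from the position at time `k`. Only increments from `k` on enter, so stationarity makes
  -- the probability independent of `k`.
  set A : ℕ → ℕ → Set Ω := fun K k => {ω | ∀ n, K ≤ n → ε ≤ |S (k + n) ω - S k ω|} with hA
  have hAm : ∀ K k, MeasurableSet (A K k) := by
    intro K k
    simp only [hA, Set.ofPred_forall]
    refine MeasurableSet.iInter fun n => MeasurableSet.iInter fun _ => ?_
    exact measurableSet_le measurable_const ((hSm _).sub (hSm _)).abs
  have hshift : ∀ K k, P (A K k) = P (A K 0) := by
    intro K k
    set B : Set (ℕ → ℝ) := {x | ∀ n, K ≤ n → ε ≤ |∑ i ∈ Finset.range n, x i|} with hB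
    have hBm : MeasurableSet B := by
      simp only [hB, Set.ofPred_forall]
      refine MeasurableSet.iInter fun n => MeasurableSet.iInter fun _ => ?_
      exact measurableSet_le measurable_const
        (Finset.measurable_sum _ fun i _ => measurable_pi_apply i).abs
    have h1 : ∀ k, A K k = (fun ω i => ξ (i + k) ω) ⁻¹' B := by
      intro k
      ext ω
      simp only [hA, hB, hS, Set.mem_ofPred_eq, Set.mem_preimage, Finset.sum_range_add,
        add_sub_cancel_left, add_comm k]
    have h2 := (hstat k).measure_mem_eq hBm
    rw [h1 k, h2, h1 0]
    rfl
  have hnull : ∀ K, P (A (K + 1) 0) = 0 := by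
    intro K
    -- The proportion of escape times before `N`: its mean is the escape probability for every `N >
    -- 0`, yet it is bounded by 1 and tends to 0 almost surely.
    set f : ℕ → Ω → ℝ := fun N ω =>
      (((Finset.range N).filter fun k => ∀ n, K + 1 ≤ n → ε ≤ |S (k + n) ω - S k ω|).card : ℝ) / N
    have hf : ∀ N, f N = fun ω => (∑ k ∈ Finset.range N, (A (K + 1) k).indicator (1 : Ω → ℝ) ω) / N := by
      intro N
      ext ω
      simp [f, Set.indicator_apply, hA]
    have hfm : ∀ N, Measurable (f N) := by
      intro N
      rw [hf N]
      exact (Finset.measurable_sum _ fun k _ =>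
        measurable_one.indicator (hAm _ k)).div_const _
    have hint : ∀ N, 0 < N → ∫ ω, f N ω ∂P = P.real (A (K + 1) 0) := by
      intro N hN
      rw [hf N, integral_div, integral_finsetSum]
      · have : ∀ k ∈ Finset.range N,
            ∫ ω, (A (K + 1) k).indicator (1 : Ω → ℝ) ω ∂P = P.real (A (K + 1) 0) := by
          intro k _
          rw [integral_indicator_one (hAm _ _), measureReal_def, hshift, measureReal_def]
        rw [Finset.sum_congr rfl this, Finset.sum_const, Finset.card_range, nsmul_eq_mul]
        field_simp
      · intro k _
        exact (integrable_const (1 : ℝ)).indicator (hAm _ _)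
    have hT : Tendsto (fun N => ∫ ω, f N ω ∂P) atTop (𝓝 (∫ _, (0 : ℝ) ∂P)) := by
      refine tendsto_integral_of_dominated_convergence (fun _ => (1 : ℝ))
        (fun N => (hfm N).aestronglyMeasurable) (integrable_const _) ?_ ?_
      · intro N
        refine Eventually.of_forall fun ω => ?_
        rw [Real.norm_of_nonneg (by positivity)]
        refine div_le_one_of_le₀ ?_ (Nat.cast_nonneg _)
        exact_mod_cast (Finset.card_filter_le _ _).trans (Finset.card_range N).le
      · filter_upwards [hlim] with ω hω
        exact tendsto_card_escape_div (s := fun n => S n ω) hω hε (Nat.succ_pos K)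
    have hconst : Tendsto (fun N => ∫ ω, f N ω ∂P) atTop (𝓝 (P.real (A (K + 1) 0))) :=
      tendsto_const_nhds.congr' (by
        filter_upwards [eventually_gt_atTop 0] with N hN using (hint N hN).symm)
    have := tendsto_nhds_unique hconst hT
    simpa [measureReal_eq_zero_iff] using this
  have hall : ∀ᵐ ω ∂P, ∀ K, ω ∉ A (K + 1) 0 :=
    ae_all_iff.2 fun K => measure_eq_zero_iff_ae_notMem.1 (hnull K)
  filter_upwards [hall] with ω hω
  rw [frequently_atTop]
  intro K
  have := hω K
  simp only [hA, hS, Set.mem_ofPred_eq, zero_add, Finset.range_zero, Finset.sum_empty, sub_zero]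
    at this
  push Not at this
  obtain ⟨n, hn, hlt⟩ := this
  exact ⟨n, by omega, hlt⟩

/-! ### Maximal inequality and integrability of independent summands -/

/-- First passage of `|x|` above the level `c` at time `k` is a measurable event. -/
theorem measurableSet_first_passage (c : ℝ) (k : ℕ) :
    MeasurableSet {x : ℕ → ℝ | c < |x k| ∧ ∀ j < k, |x j| ≤ c} := by
  rw [Set.ofPred_and]
  refine (measurableSet_lt measurable_const (measurable_pi_apply k).abs).inter ?_
  simp only [Set.ofPred_forall]
  exact MeasurableSet.iInter fun j => MeasurableSet.iInter fun _ =>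
    measurableSet_le (measurable_pi_apply j).abs measurable_const

/-- Ottaviani's maximal inequality. -/
theorem measure_exists_abs_sum_gt_le {Ω : Type*} [MeasurableSpace Ω] {P : Measure Ω}
    [IsProbabilityMeasure P] {D : ℕ → Ω → ℝ} (hm : ∀ i, Measurable (D i)) (hD : iIndepFun D P)
    (a b : ℝ) (N : ℕ)
    (h : ∀ k ≤ N, P {ω | b < |∑ i ∈ Finset.Ico k N, D i ω|} ≤ 1 / 2) :
    P {ω | ∃ k ≤ N, a + b < |∑ i ∈ Finset.range k, D i ω|}
      ≤ 2 * P {ω | a < |∑ i ∈ Finset.range N, D i ω|} := by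
  classical
  set S : ℕ → Ω → ℝ := fun n ω => ∑ i ∈ Finset.range n, D i ω with hS
  set R : ℕ → Ω → ℝ := fun n ω => ∑ i ∈ Finset.Ico n N, D i ω with hR
  have hSm : ∀ n, Measurable (S n) := fun n => Finset.measurable_sum _ fun i _ => hm i
  have hRm : ∀ n, Measurable (R n) := fun n => Finset.measurable_sum _ fun i _ => hm i
  -- The first-passage events `A k` are disjoint. `A k` depends on the increments before `k` and `B
  -- k` on those from `k` to `N`, and on `A k ∩ B k` the final sum exceeds `a` in modulus.
  set A : ℕ → Set Ω := fun k => {ω | a + b < |S k ω| ∧ ∀ j < k, |S j ω| ≤ a + b} with hA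
  set B : ℕ → Set Ω := fun k => {ω | |R k ω| ≤ b} with hB
  have hBm : ∀ k, MeasurableSet (B k) := fun k => measurableSet_le (hRm k).abs measurable_const
  have hAm : ∀ k, MeasurableSet (A k) := fun k =>
    measurable_pi_lambda (fun ω n => S n ω) hSm (measurableSet_first_passage (a + b) k)
  have hind : ∀ k, P (A k ∩ B k) = P (A k) * P (B k) := by
    intro k
    have h0 := hD.indepFun_finset (Finset.range k) (Finset.Ico k N)
      (by rw [Finset.disjoint_left]; intro i; simp; omega) hm
    -- `φ` rebuilds the partial sums up to time `k` from the first `k` increments, so first passage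
    -- becomes an event of this block alone.
    set φ : ({i // i ∈ Finset.range k} → ℝ) → ℕ → ℝ := fun x j =>
      ∑ i : {i // i ∈ Finset.range k}, if i.1 < j then x i else 0 with hφ
    set ψ : ({i // i ∈ Finset.Ico k N} → ℝ) → ℝ := fun x => ∑ i, x i with hψ
    have hφm : Measurable φ := by
      refine measurable_pi_lambda _ fun j => Finset.measurable_sum _ fun i _ => ?_
      by_cases hij : i.1 < j
      · simpa [hij] using measurable_pi_apply i
      · simp [hij]
    have hψm : Measurable ψ := Finset.measurable_sum _ fun i _ => measurable_pi_apply i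
    have h1 := h0.comp hφm hψm
    have hφS : ∀ ω, ∀ j ≤ k, φ (fun i => D i ω) j = S j ω := by
      intro ω j hj
      simp only [hφ, hS]
      rw [Finset.sum_coe_sort (Finset.range k) (fun i => if i < j then D i ω else 0),
        ← Finset.sum_filter]
      congr 1
      ext i; simp; omega
    have hψR : ∀ ω, ψ (fun i => D i ω) = R k ω := by
      intro ω
      simp only [hψ, hR]
      exact Finset.sum_coe_sort (Finset.Ico k N) (fun i => D i ω)
    have hA' : A k = (φ ∘ fun ω (i : {i // i ∈ Finset.range k}) => D i ω) ⁻¹'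
        {x | a + b < |x k| ∧ ∀ j < k, |x j| ≤ a + b} := by
      ext ω
      simp only [hA, Set.mem_ofPred_eq, Set.mem_preimage, Function.comp, hφS ω k le_rfl]
      refine and_congr_right fun _ => forall₂_congr fun j hj => ?_
      rw [hφS ω j hj.le]
    have hB' : B k = (ψ ∘ fun ω (i : {i // i ∈ Finset.Ico k N}) => D i ω) ⁻¹' {x | |x| ≤ b} := by
      ext ω
      simp only [hB, Set.mem_ofPred_eq, Set.mem_preimage, Function.comp, hψR ω]
    rw [hA', hB']
    exact h1.measure_inter_preimage_eq_mul _ _ (measurableSet_first_passage (a + b) k)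
      (measurableSet_le measurable_id.abs measurable_const)
  have hBhalf : ∀ k ≤ N, 1 / 2 ≤ P (B k) := by
    intro k hk
    have h1 : (B k)ᶜ = {ω | b < |∑ i ∈ Finset.Ico k N, D i ω|} := by
      ext ω; simp [hB, hR]
    have h2 := prob_compl_eq_one_sub (μ := P) (hBm k).compl
    rw [compl_compl, h1] at h2
    rw [h2]
    refine ENNReal.le_sub_of_add_le_right (measure_ne_top _ _) ?_
    calc (1 / 2 : ENNReal) + _ ≤ 1 / 2 + 1 / 2 := by gcongr; exact h k hk
      _ = 1 := ENNReal.add_halves 1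
  have hdisj : Pairwise (Function.onFun Disjoint A) := by
    have key : ∀ k l, k < l → Disjoint (A k) (A l) := by
      intro k l hkl
      rw [Set.disjoint_left]
      intro ω hk hl
      exact absurd hk.1 (not_lt.2 (hl.2 k hkl))
    intro k l hkl
    rcases lt_or_gt_of_ne hkl with h | h
    · exact key k l h
    · exact (key l k h).symm
  calc P {ω | ∃ k ≤ N, a + b < |S k ω|}
      ≤ P (⋃ k ∈ Finset.range (N + 1), A k) := by
        refine measure_mono fun ω hω => ?_
        obtain ⟨k, hk, hlt⟩ := hω
        have hex : ∃ k, a + b < |S k ω| := ⟨k, hlt⟩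
        simp only [Set.mem_iUnion]
        refine ⟨Nat.find hex, ?_, Nat.find_spec hex, fun j hj => not_lt.1 (Nat.find_min hex hj)⟩
        exact Finset.mem_range.2 (Nat.lt_succ_of_le ((Nat.find_min' hex hlt).trans hk))
    _ ≤ ∑ k ∈ Finset.range (N + 1), P (A k) := measure_biUnion_finset_le _ _
    _ ≤ ∑ k ∈ Finset.range (N + 1), 2 * P (A k ∩ B k) := by
        refine Finset.sum_le_sum fun k hk => ?_
        rw [hind k]
        calc P (A k) = 2 * (P (A k) * (1 / 2)) := by
              rw [mul_comm (P (A k)), ← mul_assoc, one_div,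
                ENNReal.mul_inv_cancel (by norm_num) (by norm_num), one_mul]
          _ ≤ _ := by
              gcongr
              exact hBhalf k (Nat.lt_succ_iff.1 (Finset.mem_range.1 hk))
    _ = 2 * P (⋃ k ∈ Finset.range (N + 1), A k ∩ B k) := by
        rw [← Finset.mul_sum, measure_biUnion_finset]
        · intro k _ l _ hkl
          exact (hdisj hkl).mono Set.inter_subset_left Set.inter_subset_left
        · exact fun k _ => (hAm k).inter (hBm k)
    _ ≤ 2 * P {ω | a < |S N ω|} := by
        gcongr
        intro ω hω
        simp only [Set.mem_iUnion] at hω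
        obtain ⟨k, hk, hAk, hBk⟩ := hω
        have hkN : k ≤ N := Nat.lt_succ_iff.1 (Finset.mem_range.1 hk)
        have h1 : S k ω + R k ω = S N ω := Finset.sum_range_add_sum_Ico _ hkN
        have h2 : a + b < |S k ω| := hAk.1
        have h3 : |R k ω| ≤ b := hBk
        have h4 : |S k ω| ≤ |S N ω| + |R k ω| := by
          rw [← h1]
          simpa using abs_sub (S k ω + R k ω) (R k ω)
        change a < |S N ω|
        linarith

/-- If the sum of two independent random variables is integrable, so is each summand. -/
theorem ProbabilityTheory.IndepFun.integrable_left_of_integrable_add {Ω : Type*}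
    [MeasurableSpace Ω] {P : Measure Ω} [IsProbabilityMeasure P] {U V : Ω → ℝ}
    (hU : Measurable U) (hV : Measurable V) (hUV : IndepFun U V P)
    (h : Integrable (fun ω => U ω + V ω) P) : Integrable U P := by
  obtain ⟨K, hK⟩ : ∃ K : ℕ, P {ω | |V ω| ≤ K} ≠ 0 := by
    by_contra! hcon
    have h1 : P (⋃ K : ℕ, {ω | |V ω| ≤ K}) = 0 := measure_iUnion_null hcon
    have h2 : (⋃ K : ℕ, {ω | |V ω| ≤ K}) = Set.univ := by
      ext ω
      simpa using exists_nat_ge |V ω|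
    rw [h2, measure_univ] at h1
    exact one_ne_zero h1
  -- Truncation: `U * f(V)` is dominated by |U + V| + K, hence integrable. Since `f(V)` is
  -- independent of `U` and not a.s. zero, `U` is integrable.
  set f : ℝ → ℝ := {x : ℝ | |x| ≤ K}.indicator 1 with hf
  have hset : MeasurableSet {x : ℝ | |x| ≤ K} := measurableSet_le measurable_id.abs measurable_const
  have hfm : Measurable f := measurable_one.indicator hset
  have hind : IndepFun U (f ∘ V) P := hUV.comp measurable_id hfm
  refine hind.integrable_left_of_integrable_op (fun x y => x * y) 1 one_ne_zero
    (fun x y => by simp [enorm_mul]) ?_ hU.aestronglyMeasurable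
    (hfm.comp hV).aestronglyMeasurable ?_
  · refine (h.norm.add (integrable_const (K : ℝ))).mono'
      (hU.mul (hfm.comp hV)).aestronglyMeasurable (Eventually.of_forall fun ω => ?_)
    by_cases hω : |V ω| ≤ K
    · have h1 : f (V ω) = 1 := by simp [hf, hω]
      simp only [Function.comp, h1, mul_one, Pi.add_apply, Real.norm_eq_abs]
      have := abs_sub (U ω + V ω) (V ω)
      rw [add_sub_cancel_right] at this
      linarith
    · have h1 : f (V ω) = 0 := by simp [hf, hω]
      simp only [Function.comp, h1, mul_zero, norm_zero, Pi.add_apply]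
      positivity
  · intro h0
    apply hK
    rw [measure_eq_zero_iff_ae_notMem]
    filter_upwards [h0] with ω hω hle
    have h1 : f (V ω) = 1 := by
      have : |V ω| ≤ K := hle
      simp [hf, this]
    simp [h1] at hω

/-! ### Periodic time grids -/

/-- The period-`p` grid `0, u, v, p, p + u, p + v, 2p, …`. -/
noncomputable def periodicGrid (p u v : ℝ≥0) (i : ℕ) : ℝ≥0 :=
  (i / 3 : ℕ) * p + if i % 3 = 0 then 0 else if i % 3 = 1 then u else v

section periodicGrid
variable {p u v : ℝ≥0}

theorem periodicGrid_three_mul (k : ℕ) : periodicGrid p u v (3 * k) = k * p := by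
  simp [periodicGrid]

theorem periodicGrid_three_mul_add_one (k : ℕ) : periodicGrid p u v (3 * k + 1) = k * p + u := by
  have h1 : (3 * k + 1) / 3 = k := by omega
  have h2 : (3 * k + 1) % 3 = 1 := by omega
  simp [periodicGrid, h1, h2]

theorem periodicGrid_three_mul_add_two (k : ℕ) : periodicGrid p u v (3 * k + 2) = k * p + v := by
  have h1 : (3 * k + 2) / 3 = k := by omega
  have h2 : (3 * k + 2) % 3 = 2 := by omega
  simp [periodicGrid, h1, h2]

theorem periodicGrid_add_three_mul (i m : ℕ) :
    periodicGrid p u v (i + 3 * m) = m * p + periodicGrid p u v i := by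
  have h1 : (i + 3 * m) / 3 = i / 3 + m := by omega
  have h2 : (i + 3 * m) % 3 = i % 3 := by omega
  simp only [periodicGrid, h1, h2]
  push_cast
  ring

theorem monotone_periodicGrid (huv : u ≤ v) (hvp : v ≤ p) : Monotone (periodicGrid p u v) := by
  refine monotone_nat_of_le_succ fun i => ?_
  obtain ⟨k, hk⟩ : ∃ k, i = 3 * k ∨ i = 3 * k + 1 ∨ i = 3 * k + 2 := ⟨i / 3, by omega⟩
  rcases hk with rfl | rfl | rfl
  · rw [periodicGrid_three_mul, periodicGrid_three_mul_add_one]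
    exact le_self_add
  · rw [periodicGrid_three_mul_add_one, periodicGrid_three_mul_add_two]
    gcongr
  · rw [periodicGrid_three_mul_add_two, show 3 * k + 2 + 1 = 3 * (k + 1) by ring,
      periodicGrid_three_mul]
    push_cast
    rw [add_mul, one_mul]
    gcongr

end periodicGrid

/-! ### Increments of Lévy processes and their maximal inequality -/

/-- Two sequences of independent random variables with the same marginals have the same law. -/
theorem ProbabilityTheory.iIndepFun.identDistrib_pi {Ω : Type*} [MeasurableSpace Ω]
    {P : Measure Ω} {D D' : ℕ → Ω → ℝ}
    (hm : ∀ i, Measurable (D i)) (hm' : ∀ i, Measurable (D' i)) (hD : iIndepFun D P)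
    (hD' : iIndepFun D' P) (h : ∀ i, IdentDistrib (D i) (D' i) P P) :
    IdentDistrib (fun ω i => D i ω) (fun ω i => D' i ω) P P where
  aemeasurable_fst := (measurable_pi_lambda _ hm).aemeasurable
  aemeasurable_snd := (measurable_pi_lambda _ hm').aemeasurable
  map_eq := by
    rw [hD.map_fun_eq_infinitePi_map hm, hD'.map_fun_eq_infinitePi_map hm']
    congr 1
    ext1 i
    exact (h i).map_eq

namespace IsLevyProcess

variable {Ω : Type*} [MeasurableSpace Ω] {P : Measure Ω} {Y : ℝ≥0 → Ω → ℝ}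

theorem measurable_sub (hY : IsLevyProcess Y P) (s t : ℝ≥0) :
    Measurable fun ω => Y t ω - Y s ω :=
  (hY.measurable t).sub (hY.measurable s)

theorem identDistrib_sub (hY : IsLevyProcess Y P) (s h : ℝ≥0) :
    IdentDistrib (fun ω => Y (s + h) ω - Y s ω) (Y h) P P := by
  refine (hY.stationaryIncrements s 0 h).trans ?_
  refine IdentDistrib.of_ae_eq (hY.measurable_sub _ _).aemeasurable ?_
  filter_upwards [hY.start_zero] with ω hω
  simp [hω]

/-- The increments over a periodic grid form a sequence that is stationary under whole periods. -/
theorem identDistrib_increments (hY : IsLevyProcess Y P) {p u v : ℝ≥0} (huv : u ≤ v)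
    (hvp : v ≤ p) (m : ℕ) :
    IdentDistrib
      (fun ω i => Y (periodicGrid p u v (i + 3 * m + 1)) ω - Y (periodicGrid p u v (i + 3 * m)) ω)
      (fun ω i => Y (periodicGrid p u v (i + 1)) ω - Y (periodicGrid p u v i) ω) P P := by
  have hmono := monotone_periodicGrid huv hvp
  have hind := hY.indepIncrements.nat hmono
  refine iIndepFun.identDistrib_pi (fun i => hY.measurable_sub _ _)
    (fun i => hY.measurable_sub _ _) (hind.precomp (g := fun i => i + 3 * m)
      (fun i j hij => by simpa using hij)) hind fun i => ?_
  obtain ⟨h, hh⟩ := exists_add_of_le (hmono (Nat.le_succ i))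
  have := hY.stationaryIncrements (m * p + periodicGrid p u v i) (periodicGrid p u v i) h
  rw [show i + 3 * m + 1 = (i + 1) + 3 * m by ring, periodicGrid_add_three_mul,
    periodicGrid_add_three_mul]
  rw [Nat.succ_eq_add_one] at hh
  rw [hh, ← add_assoc]
  exact this

/-- Y_t is a.s. the sum of the independent variables Y_s and Y_t - Y_s. -/
theorem integrable_of_le [IsProbabilityMeasure P] (hY : IsLevyProcess Y P) {s t : ℝ≥0}
    (hst : s ≤ t) (ht : Integrable (Y t) P) : Integrable (Y s) P := by
  have h := hY.indepIncrements.indepFun_eval_sub (zero_le : 0 ≤ s) hst hY.start_zero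
  exact h.integrable_left_of_integrable_add (hY.measurable s) (hY.measurable_sub s t)
    (by simpa using ht)

theorem integrable [IsProbabilityMeasure P] (hY : IsLevyProcess Y P) (h1 : Integrable (Y 1) P)
    (t : ℝ≥0) : Integrable (Y t) P := by
  have hn : ∀ n : ℕ, Integrable (Y n) P := by
    intro n
    induction n with
    | zero =>
      refine (integrable_zero Ω ℝ P).congr ?_
      filter_upwards [hY.start_zero] with ω hω
      simp [hω]
    | succ n ih =>
      have h2 := ((hY.identDistrib_sub n 1).integrable_iff).2 h1
      push_cast
      refine (ih.add h2).congr (Eventually.of_forall fun ω => ?_)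
      simp
  obtain ⟨n, hnt⟩ := exists_nat_ge t
  exact hY.integrable_of_le hnt (hn n)

/-- Strong law of large numbers for the increments over the time windows `(kp, kp + w]`. -/
theorem tendsto_sum_increments_div [IsProbabilityMeasure P] (hY : IsLevyProcess Y P)
    (h1 : Integrable (Y 1) P) (s : ℝ≥0) {p w : ℝ≥0} (hwp : w ≤ p) :
    ∀ᵐ ω ∂P, Tendsto (fun n : ℕ => (∑ k ∈ Finset.range n,
      (Y (s + k * p + w) ω - Y (s + k * p) ω)) / n) atTop (𝓝 P[Y w]) := by
  -- With `u = v = w` one cell of the grid degenerates; keeping every third increment leaves exactly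
  -- the windows, and independence is inherited.
  have hmono : Monotone fun i => s + periodicGrid p w w i :=
    monotone_const.add (monotone_periodicGrid le_rfl hwp)
  have hind := (hY.indepIncrements.nat hmono).precomp (g := fun k : ℕ => 3 * k)
    (fun i j hij => by simpa using hij)
  have hgrid : (fun (k : ℕ) ω => Y (s + periodicGrid p w w (3 * k + 1)) ω
      - Y (s + periodicGrid p w w (3 * k)) ω)
      = fun (k : ℕ) ω => Y (s + k * p + w) ω - Y (s + k * p) ω := by
    ext k ω
    rw [periodicGrid_three_mul_add_one, periodicGrid_three_mul, add_assoc]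
  have hind' : iIndepFun (fun (k : ℕ) ω => Y (s + k * p + w) ω - Y (s + k * p) ω) P := by
    rw [← hgrid]; exact hind
  have hid : ∀ k : ℕ, IdentDistrib (fun ω => Y (s + k * p + w) ω - Y (s + k * p) ω) (Y w) P P :=
    fun k => hY.identDistrib_sub _ _
  have := strong_law_ae_real (fun (k : ℕ) ω => Y (s + k * p + w) ω - Y (s + k * p) ω)
    ((hid 0).integrable_iff.2 (hY.integrable h1 w)) (fun i j hij => hind'.indepFun hij)
    (fun i => (hid i).trans (hid 0).symm)
  rwa [(hid 0).integral_eq] at this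

theorem tendsto_nat_mul_div [IsProbabilityMeasure P] (hY : IsLevyProcess Y P)
    (h1 : Integrable (Y 1) P) (w : ℝ≥0) :
    ∀ᵐ ω ∂P, Tendsto (fun n : ℕ => Y (n * w) ω / n) atTop (𝓝 P[Y w]) := by
  filter_upwards [hY.tendsto_sum_increments_div h1 0 (le_refl w), hY.start_zero] with ω hω h0
  refine hω.congr fun n => ?_
  have : ∀ k : ℕ, Y (0 + k * w + w) ω - Y (0 + k * w) ω
      = Y ((k + 1 : ℕ) * w) ω - Y (k * w) ω := by
    intro k
    push_cast
    rw [zero_add, add_mul, one_mul]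
  simp only [this]
  rw [Finset.sum_range_sub (fun k : ℕ => Y (k * w) ω)]
  simp [h0]

/-- Stochastic continuity at 0 supplies a time step for which Ottaviani's hypothesis holds with `b =
1`. -/
theorem exists_pos_measure_le_half (hY : IsLevyProcess Y P) :
    ∃ δ : ℝ≥0, 0 < δ ∧ ∀ u ≤ δ, P {ω | 1 < |Y u ω|} ≤ 1 / 2 := by
  have h := hY.stochContinuous 0 1 one_pos
  have h2 := (ENNReal.tendsto_nhds_zero.1 h) (1 / 2) (by simp)
  obtain ⟨δ, hδ, hball⟩ := Metric.eventually_nhds_iff.1 h2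
  refine ⟨(δ / 2).toNNReal, Real.toNNReal_pos.2 (half_pos hδ), fun u hu => ?_⟩
  have hu' : (u : ℝ) ≤ δ / 2 := (Real.le_toNNReal_iff_coe_le (half_pos hδ).le).1 hu
  refine (measure_mono_ae ?_).trans (hball (y := u) ?_)
  · filter_upwards [hY.start_zero] with ω h0 hω
    have hω' : 1 < |Y u ω| := hω
    change 1 ≤ edist (Y u ω) (Y 0 ω)
    rw [h0, edist_dist, ENNReal.one_le_ofReal, Real.dist_eq, sub_zero]
    exact hω'.le
  · rw [NNReal.dist_eq, NNReal.coe_zero, sub_zero, abs_of_nonneg u.coe_nonneg]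
    linarith

/-- Maximal inequality over a dyadic grid. -/
theorem measure_exists_dyadic_le [IsProbabilityMeasure P] (hY : IsLevyProcess Y P) {δ : ℝ≥0}
    (hδ : ∀ u ≤ δ, P {ω | 1 < |Y u ω|} ≤ 1 / 2) (h : ℝ≥0) (a : ℝ) (j : ℕ) :
    P {ω | ∃ k : ℕ, k ≤ 2 ^ j ∧ a + 1 < |Y (h + k * (δ / 2 ^ j)) ω - Y h ω|}
      ≤ 2 * P {ω | a < |Y δ ω|} := by
  set t : ℕ → ℝ≥0 := fun i => h + i * (δ / 2 ^ j) with ht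
  have hmono : Monotone t := fun i i' hii => by
    simp only [ht]; gcongr
  have hind := hY.indepIncrements.nat hmono
  have htN : t (2 ^ j) = h + δ := by
    simp only [ht]
    push_cast
    congr 1
    field_simp
  have := measure_exists_abs_sum_gt_le (fun i => hY.measurable_sub _ _) hind a 1 (2 ^ j) ?_
  · have hsum : ∀ n ω, ∑ i ∈ Finset.range n, (Y (t (i + 1)) ω - Y (t i) ω)
        = Y (t n) ω - Y (t 0) ω := fun n ω => Finset.sum_range_sub (fun i => Y (t i) ω) n
    simp only [hsum, htN] at this
    have ht0 : t 0 = h := by simp [ht]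
    rw [ht0] at this
    refine this.trans (le_of_eq ?_)
    congr 1
    exact (hY.identDistrib_sub h δ).measure_mem_eq (s := {x : ℝ | a < |x|})
      (measurableSet_lt measurable_const measurable_id.abs)
  · intro k hk
    have hsum : ∀ ω, ∑ i ∈ Finset.Ico k (2 ^ j), (Y (t (i + 1)) ω - Y (t i) ω)
        = Y (t (2 ^ j)) ω - Y (t k) ω := fun ω => Finset.sum_Ico_sub (fun i => Y (t i) ω) hk
    simp only [hsum]
    obtain ⟨u, hu⟩ := exists_add_of_le (hmono hk)
    have huδ : u ≤ δ := by
      have h1 : h + δ = t k + u := by rw [← htN, hu]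
      have h2 : h ≤ t k := le_self_add
      have h3 : h + u ≤ h + δ := by rw [h1]; gcongr
      exact le_of_add_le_add_left h3
    rw [hu]
    refine (le_of_eq ?_).trans (hδ u huδ)
    exact (hY.identDistrib_sub (t k) u).measure_mem_eq (s := {x : ℝ | 1 < |x|})
      (measurableSet_lt measurable_const measurable_id.abs)

/-- Maximal inequality over a short time interval. -/
theorem measure_exists_Ico_le [IsProbabilityMeasure P] (hY : IsLevyProcess Y P) {δ : ℝ≥0}
    (hδ0 : 0 < δ) (hδ : ∀ u ≤ δ, P {ω | 1 < |Y u ω|} ≤ 1 / 2) (h : ℝ≥0) (a : ℝ) :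
    P {ω | ∃ t ∈ Set.Ico h (h + δ), a + 1 < |Y t ω - Y h ω|} ≤ 2 * P {ω | a < |Y δ ω|} := by
  -- These events increase under refinement, so the dyadic bound, uniform in `j`, passes to their
  -- union. By right-continuity, the strict inequality at `t` persists at dyadic points just to its
  -- right.
  set E : ℕ → Set Ω := fun j => {ω | ∃ k : ℕ, k ≤ 2 ^ j ∧ a + 1 < |Y (h + k * (δ / 2 ^ j)) ω - Y h ω|}
    with hE
  have hmono : Monotone E := by
    refine monotone_nat_of_le_succ fun j ω hω => ?_
    obtain ⟨k, hk, hlt⟩ := hω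
    refine ⟨2 * k, by rw [pow_succ]; lia, ?_⟩
    have : ((2 * k : ℕ) : ℝ≥0) * (δ / 2 ^ (j + 1)) = k * (δ / 2 ^ j) := by
      push_cast
      rw [pow_succ]
      field_simp
    rwa [this]
  have hE_le : P (⋃ j, E j) ≤ 2 * P {ω | a < |Y δ ω|} := by
    rw [hmono.measure_iUnion]
    exact iSup_le fun j => hY.measure_exists_dyadic_le hδ h a j
  refine (measure_mono_ae ?_).trans hE_le
  filter_upwards [hY.cadlag] with ω hω hex
  obtain ⟨t, ⟨hht, hth⟩, hlt⟩ := hex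
  obtain ⟨r, rfl⟩ := exists_add_of_le hht
  have hrδ : r < δ := lt_of_add_lt_add_left hth
  -- dyadic approximation of `h + r` from the right
  set k : ℕ → ℕ := fun j => ⌊r / (δ / 2 ^ j)⌋₊ + 1 with hk
  have hpos : ∀ j : ℕ, 0 < δ / 2 ^ j := fun j => by positivity
  have hgt : ∀ j, h + r < h + k j * (δ / 2 ^ j) := by
    intro j
    gcongr
    have := Nat.lt_floor_add_one (r / (δ / 2 ^ j))
    rw [div_lt_iff₀ (hpos j)] at this
    simpa [hk] using this
  have hle : ∀ j, h + k j * (δ / 2 ^ j) ≤ h + r + δ / 2 ^ j := by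
    intro j
    have := Nat.floor_le (zero_le : 0 ≤ r / (δ / 2 ^ j))
    rw [le_div_iff₀ (hpos j)] at this
    simp only [hk]
    push_cast
    rw [add_mul, one_mul, add_assoc]
    gcongr
  -- Rounding up stays within the grid because `r < δ`; this is why the time interval is half-open.
  have hk2 : ∀ j, k j ≤ 2 ^ j := by
    intro j
    refine Nat.succ_le_of_lt ((Nat.floor_lt zero_le).2 ?_)
    rw [div_lt_iff₀ (hpos j)]
    push_cast
    rwa [mul_div_cancel₀ _ (by positivity : (2 : ℝ≥0) ^ j ≠ 0)]
  have hlim0 : Tendsto (fun j : ℕ => h + r + δ / 2 ^ j) atTop (𝓝 (h + r)) := by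
    have : Tendsto (fun j : ℕ => δ * (1 / 2 : ℝ≥0) ^ j) atTop (𝓝 (δ * 0)) := by
      refine Tendsto.const_mul _ ?_
      exact NNReal.tendsto_pow_atTop_nhds_zero_of_lt_one (by
        rw [← NNReal.coe_lt_coe]; push_cast; norm_num)
    have h2 := this.const_add (h + r)
    rw [mul_zero, add_zero] at h2
    refine h2.congr fun j => ?_
    rw [one_div, inv_pow, div_eq_mul_inv]
  have hlim : Tendsto (fun j : ℕ => h + k j * (δ / 2 ^ j)) atTop (𝓝[>] (h + r)) := by
    refine tendsto_nhdsWithin_iff.2 ⟨?_, Eventually.of_forall hgt⟩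
    exact tendsto_of_tendsto_of_tendsto_of_le_of_le tendsto_const_nhds hlim0
      (fun j => (hgt j).le) hle
  have hY_lim := (hω.1 (h + r)).tendsto.comp hlim
  have habs : Tendsto (fun j : ℕ => |Y (h + k j * (δ / 2 ^ j)) ω - Y h ω|) atTop
      (𝓝 |Y (h + r) ω - Y h ω|) := (hY_lim.sub_const _).abs
  obtain ⟨j, hj⟩ := (habs.eventually_const_lt hlt).exists
  exact Set.mem_iUnion.2 ⟨j, k j, hk2 j, hj⟩

end IsLevyProcess

/-! ### Law of large numbers in continuous time -/

theorem NNReal.tendsto_natFloor_div_atTop {p : ℝ≥0} (hp : 0 < p) :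
    Tendsto (fun t : ℝ≥0 => ⌊t / p⌋₊) atTop atTop :=
  tendsto_nat_floor_atTop.comp (tendsto_id.atTop_div_const hp)

theorem NNReal.tendsto_natFloor_div_div {p : ℝ≥0} (hp : 0 < p) :
    Tendsto (fun t : ℝ≥0 => (⌊t / p⌋₊ : ℝ) / t) atTop (𝓝 (p : ℝ)⁻¹) := by
  have hp' : (0 : ℝ) < p := hp
  have h1 : Tendsto (fun t : ℝ≥0 => (t : ℝ) / p) atTop atTop :=
    (NNReal.tendsto_coe_atTop.2 tendsto_id).atTop_div_const hp'
  have h2 := (tendsto_nat_floor_div_atTop (R := ℝ)).comp h1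
  have h3 := h2.mul_const (p : ℝ)⁻¹
  rw [one_mul] at h3
  refine h3.congr fun t => ?_
  have h4 : ⌊t / p⌋₊ = ⌊(t : ℝ) / p⌋₊ := by
    rw [← NNReal.coe_div]
    exact eq_of_forall_le_iff fun n => by
      rw [Nat.le_floor_iff zero_le, Nat.le_floor_iff (NNReal.coe_nonneg _)]
      exact_mod_cast Iff.rfl
  simp only [Function.comp, h4]
  field_simp

theorem NNReal.natFloor_div_mul_le {p : ℝ≥0} (hp : 0 < p) (t : ℝ≥0) : ⌊t / p⌋₊ * p ≤ t := by
  have := Nat.floor_le (zero_le : 0 ≤ t / p)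
  rwa [le_div_iff₀ hp] at this

theorem NNReal.lt_natFloor_div_add_one_mul {p : ℝ≥0} (hp : 0 < p) (t : ℝ≥0) :
    t < (⌊t / p⌋₊ + 1) * p := by
  have := Nat.lt_floor_add_one (t / p)
  rwa [div_lt_iff₀ hp] at this

/-- A function that grows linearly along the multiples of `δ` and oscillates sublinearly in between
grows linearly. -/
theorem tendsto_div_of_tendsto_nat_mul {y : ℝ≥0 → ℝ} {δ : ℝ≥0} (hδ : 0 < δ) {m : ℝ}
    (hy : Tendsto (fun n : ℕ => y (n * δ) / n) atTop (𝓝 m))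
    (hosc : ∀ ε > 0, ∀ᶠ n : ℕ in atTop, ∀ t ∈ Set.Ico (n * δ) (n * δ + δ),
      |y t - y (n * δ)| ≤ ε * n + 1) :
    Tendsto (fun t : ℝ≥0 => y t / t) atTop (𝓝 (m / δ)) := by
  have hfl := NNReal.tendsto_natFloor_div_atTop hδ
  have h1 : Tendsto (fun t : ℝ≥0 => (y t - y (⌊t / δ⌋₊ * δ)) / ⌊t / δ⌋₊) atTop (𝓝 0) := by
    rw [Metric.tendsto_nhds]
    intro ε hε
    -- Past `2 / ε` the additive 1 of the oscillation bound is absorbed by `ε / 2 * n`.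
    obtain ⟨N, hN⟩ := exists_nat_gt (2 / ε)
    filter_upwards [hfl.eventually (hosc (ε / 2) (by positivity)), hfl.eventually_gt_atTop N]
      with t ht hNt
    have hNt' : (N : ℝ) < ⌊t / δ⌋₊ := by exact_mod_cast hNt
    have h0 : (0 : ℝ) < ⌊t / δ⌋₊ := (Nat.cast_nonneg N).trans_lt hNt'
    have h2 := ht t ⟨NNReal.natFloor_div_mul_le hδ t, by
      simpa [add_mul] using NNReal.lt_natFloor_div_add_one_mul hδ t⟩
    rw [Real.dist_eq, sub_zero, abs_div, abs_of_pos h0, div_lt_iff₀ h0]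
    rw [div_lt_iff₀ hε] at hN
    nlinarith
  have h2 : Tendsto (fun t : ℝ≥0 => y (⌊t / δ⌋₊ * δ) / ⌊t / δ⌋₊) atTop (𝓝 m) := hy.comp hfl
  have h3 := (h1.add h2).mul (NNReal.tendsto_natFloor_div_div hδ)
  rw [zero_add, ← div_eq_mul_inv] at h3
  refine h3.congr' ?_
  filter_upwards [hfl.eventually_gt_atTop 0] with t ht
  have h0 : (⌊t / δ⌋₊ : ℝ) ≠ 0 := by exact_mod_cast ht.ne'
  rw [← add_div, sub_add_cancel]
  field_simp

theorem MeasureTheory.Integrable.tsum_measure_mul_lt {Ω : Type*} [MeasurableSpace Ω]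
    {P : Measure Ω} [IsProbabilityMeasure P] {U : Ω → ℝ} (hU : Integrable U P) {ε : ℝ}
    (hε : 0 < ε) : ∑' n : ℕ, P {ω | ε * n < |U ω|} ≠ ⊤ := by
  -- `tsum_prob_mem_Ioi_lt_top` refers to the ambient volume, so `P` is made the volume.
  let : MeasureSpace Ω := ⟨P⟩
  have hU' : Integrable (fun ω => |U ω| / ε) := (hU.abs).div_const ε
  have := tsum_prob_mem_Ioi_lt_top hU' (fun ω => by positivity)
  refine ne_of_lt (lt_of_le_of_lt (le_of_eq ?_) this)
  congr 1
  ext n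
  congr 1
  ext ω
  simp only [Set.mem_ofPred_eq, Set.mem_Ioi]
  rw [lt_div_iff₀ hε, mul_comm]

namespace IsLevyProcess

variable {Ω : Type*} [MeasurableSpace Ω] {P : Measure Ω} [IsProbabilityMeasure P]
  {Y : ℝ≥0 → Ω → ℝ}

/-- Borel–Cantelli: by the maximal inequality a large oscillation on the n-th cell has probability
at most 2 P(|Y_δ| > εn), which is summable because Y_δ is integrable. -/
theorem ae_eventually_oscillation_le (hY : IsLevyProcess Y P) (h1 : Integrable (Y 1) P)
    {δ : ℝ≥0} (hδ0 : 0 < δ) (hδ : ∀ u ≤ δ, P {ω | 1 < |Y u ω|} ≤ 1 / 2) :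
    ∀ᵐ ω ∂P, ∀ ε > 0, ∀ᶠ n : ℕ in atTop, ∀ t ∈ Set.Ico (n * δ) (n * δ + δ),
      |Y t ω - Y (n * δ) ω| ≤ ε * n + 1 := by
  -- Countably many thresholds suffice, so one null set serves every `ε`.
  have hrat : ∀ᵐ ω ∂P, ∀ m : ℕ, ∀ᶠ n : ℕ in atTop, ∀ t ∈ Set.Ico (n * δ) (n * δ + δ),
      |Y t ω - Y (n * δ) ω| ≤ 1 / ((m : ℝ) + 1) * n + 1 := by
    rw [ae_all_iff]
    intro m
    have hm : (0 : ℝ) < 1 / ((m : ℝ) + 1) := by positivity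
    have hsum : ∑' n : ℕ, P {ω | ∃ t ∈ Set.Ico (n * δ) (n * δ + δ),
        1 / ((m : ℝ) + 1) * n + 1 < |Y t ω - Y (n * δ) ω|} ≠ ⊤ := by
      refine ne_top_of_le_ne_top (b := ∑' n : ℕ, 2 * P {ω | 1 / ((m : ℝ) + 1) * n < |Y δ ω|}) ?_ ?_
      · rw [ENNReal.tsum_mul_left]
        exact ENNReal.mul_ne_top (by norm_num)
          ((hY.integrable h1 δ).tsum_measure_mul_lt hm)
      · exact ENNReal.tsum_le_tsum fun n => hY.measure_exists_Ico_le hδ0 hδ _ _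
    filter_upwards [ae_eventually_notMem hsum] with ω hω
    filter_upwards [hω] with n hn t ht
    by_contra! hlt
    exact hn ⟨t, ht, hlt⟩
  filter_upwards [hrat] with ω hω ε hε
  obtain ⟨m, hm⟩ := exists_nat_one_div_lt hε
  filter_upwards [hω m] with n hn t ht
  refine (hn t ht).trans ?_
  gcongr

theorem exists_tendsto_div (hY : IsLevyProcess Y P) (h1 : Integrable (Y 1) P) :
    ∃ c : ℝ, ∀ᵐ ω ∂P, Tendsto (fun t : ℝ≥0 => Y t ω / t) atTop (𝓝 c) := by
  obtain ⟨δ, hδ0, hδ⟩ := hY.exists_pos_measure_le_half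
  refine ⟨P[Y δ] / δ, ?_⟩
  filter_upwards [hY.tendsto_nat_mul_div h1 δ, hY.ae_eventually_oscillation_le h1 hδ0 hδ]
    with ω hω hosc
  exact tendsto_div_of_tendsto_nat_mul hδ0 hω hosc

/-- The mean of an integrable Lévy process is linear in time, and the strong law of large numbers
holds in continuous time. -/
theorem integral_eq_and_tendsto_div (hY : IsLevyProcess Y P) (h1 : Integrable (Y 1) P) :
    (∀ t : ℝ≥0, P[Y t] = (t : ℝ) * P[Y 1]) ∧
      ∀ᵐ ω ∂P, Tendsto (fun t : ℝ≥0 => Y t ω / t) atTop (𝓝 P[Y 1]) := by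
  obtain ⟨c, hc⟩ := hY.exists_tendsto_div h1
  -- Along the multiples of `t`, the discrete law gives Y_{nt} / n → E[Y_t] and the continuous one
  -- gives the limit `t * c`.
  have key : ∀ t : ℝ≥0, P[Y t] = t * c := by
    intro t
    rcases eq_or_ne t 0 with rfl | ht
    · rw [NNReal.coe_zero, zero_mul]
      exact (integral_congr_ae hY.start_zero).trans (by simp)
    obtain ⟨ω, hω, hω'⟩ := (hc.and (hY.tendsto_nat_mul_div h1 t)).exists
    have ht0 : 0 < t := pos_iff_ne_zero.2 ht
    have htop : Tendsto (fun n : ℕ => (n : ℝ≥0) * t) atTop atTop :=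
      tendsto_natCast_atTop_atTop.atTop_mul_const ht0
    have h2 := (hω.comp htop).const_mul (t : ℝ)
    refine tendsto_nhds_unique hω' (h2.congr' ?_)
    filter_upwards [eventually_gt_atTop 0] with n hn
    have hn' : (n : ℝ) ≠ 0 := by exact_mod_cast hn.ne'
    have ht' : (t : ℝ) ≠ 0 := by exact_mod_cast ht
    simp only [Function.comp]
    push_cast
    field_simp
  have hc1 : P[Y 1] = c := by simpa using key 1
  refine ⟨fun t => ?_, ?_⟩
  · rw [hc1]; exact key t
  · rw [hc1]; exact hc

end IsLevyProcess

/-! ### Recurrence and transience from the growth rate -/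

theorem tendsto_norm_atTop_of_tendsto_div {x : ℝ≥0 → ℝ} {c : ℝ} (hc : c ≠ 0)
    (hx : Tendsto (fun t : ℝ≥0 => x t / t) atTop (𝓝 c)) :
    Tendsto (fun t => ‖x t‖) atTop atTop := by
  have h := hx.norm.pos_mul_atTop (norm_pos_iff.2 hc) (NNReal.tendsto_coe_atTop.2 tendsto_id)
  refine h.congr' ?_
  filter_upwards [eventually_gt_atTop 0] with t ht
  have ht' : (0 : ℝ) < t := ht
  simp only [norm_div, id, Real.norm_of_nonneg ht'.le]
  field_simp

section Criteria

variable {Ω : Type*} [MeasurableSpace Ω] {P : Measure Ω} {W : ℝ≥0 → Ω → ℝ}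

/-- A transient path stays away from each of its points in the long run. -/
theorem IsTransientProcess.not_isRecurrentFrom [NeZero P] (h : IsTransientProcess W P) (s : ℝ≥0) :
    ¬ IsRecurrentFrom s W P := by
  intro hr
  obtain ⟨ω, h1, h2⟩ := (h.and hr).exists
  have h3 : ∀ᶠ t in atTop, (1 : ENNReal) ≤ ‖W t ω - W s ω‖ₑ := by
    filter_upwards [h1.eventually_ge_atTop (‖W s ω‖ + 1)] with t ht
    rw [← ofReal_norm, ENNReal.one_le_ofReal]
    linarith [norm_sub_norm_le (W t ω) (W s ω)]
  have h4 := le_liminf_of_le (by isBoundedDefault) h3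
  rw [h2] at h4
  simp at h4

/-- A process of sublinear growth whose increments over the periods of length `p` after time `s`
are stationary is recurrent from `s`. -/
theorem isRecurrentFrom_of_stationary [IsProbabilityMeasure P] {s p : ℝ≥0} (hp : 0 < p)
    {ξ : ℕ → Ω → ℝ} (hm : ∀ i, Measurable (ξ i))
    (hstat : ∀ k, IdentDistrib (fun ω i => ξ (i + k) ω) (fun ω i => ξ i ω) P P)
    (hξ : ∀ᵐ ω ∂P, ∀ j : ℕ, W (s + (j + 1 : ℕ) * p) ω - W (s + j * p) ω = ξ j ω)
    (hW : ∀ᵐ ω ∂P, Tendsto (fun t : ℝ≥0 => W t ω / t) atTop (𝓝 0)) :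
    IsRecurrentFrom s W P := by
  have hsum : ∀ᵐ ω ∂P, ∀ n : ℕ, ∑ i ∈ Finset.range n, ξ i ω = W (s + n * p) ω - W s ω := by
    filter_upwards [hξ] with ω hω n
    simp only [← hω]
    rw [Finset.sum_range_sub (fun j : ℕ => W (s + j * p) ω)]
    simp
  have htop : Tendsto (fun n : ℕ => s + n * p) atTop atTop :=
    tendsto_atTop_mono (fun _ => le_add_self) (tendsto_natCast_atTop_atTop.atTop_mul_const hp)
  have hlim : ∀ᵐ ω ∂P, Tendsto (fun n : ℕ => (∑ i ∈ Finset.range n, ξ i ω) / n) atTop (𝓝 0) := by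
    filter_upwards [hsum, hW] with ω hω hω0
    have h1 : Tendsto (fun n : ℕ => ((s : ℝ) / n + p)) atTop (𝓝 (0 + p)) :=
      (tendsto_const_div_atTop_nhds_zero_nat _).add_const _
    have h2 := ((hω0.comp htop).mul h1).sub (tendsto_const_div_atTop_nhds_zero_nat (W s ω))
    rw [zero_mul, sub_zero] at h2
    refine h2.congr' ?_
    filter_upwards [eventually_gt_atTop 0] with n hn
    have hn' : (0 : ℝ) < n := by exact_mod_cast hn
    have hp' : (0 : ℝ) < p := hp
    have hs' : (0 : ℝ) ≤ s := s.coe_nonneg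
    have hne : (s : ℝ) + n * p ≠ 0 := by positivity
    rw [hω n]
    simp only [Function.comp]
    push_cast
    field_simp
  have hfreq : ∀ᵐ ω ∂P, ∀ m : ℕ, ∃ᶠ n in atTop,
      |∑ i ∈ Finset.range n, ξ i ω| < 1 / ((m : ℝ) + 1) :=
    ae_all_iff.2 fun m => ae_frequently_abs_sum_lt hm hstat hlim (by positivity)
  filter_upwards [hsum, hfreq] with ω hω hfr
  refine le_antisymm (ENNReal.le_of_forall_pos_le_add fun ε hε _ => ?_) zero_le
  rw [zero_add]
  refine liminf_le_of_frequently_le' ?_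
  obtain ⟨m, hm⟩ := exists_nat_one_div_lt (K := ℝ) (NNReal.coe_pos.2 hε)
  refine htop.frequently ((hfr m).mono fun n hn => ?_)
  rw [hω n] at hn
  rw [← ofReal_norm, ← ENNReal.ofReal_coe_nnreal]
  exact ENNReal.ofReal_le_ofReal (hn.trans hm).le

/-- Recurrence and transience are decided by the linear growth rate. -/
theorem recurrent_iff_and_transient_iff [IsProbabilityMeasure P] {c : ℝ}
    (hW : ∀ᵐ ω ∂P, Tendsto (fun t : ℝ≥0 => W t ω / t) atTop (𝓝 c))
    (hrec : c = 0 → IsRecurrentProcess W P) :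
    (IsRecurrentProcess W P ↔ c = 0) ∧ (IsTransientProcess W P ↔ c ≠ 0) := by
  have htr : c ≠ 0 → IsTransientProcess W P := fun hc => by
    filter_upwards [hW] with ω hω using tendsto_norm_atTop_of_tendsto_div hc hω
  refine ⟨⟨fun h => ?_, hrec⟩, ⟨fun h hc => h.not_isRecurrentFrom 0 (hrec hc 0), htr⟩⟩
  by_contra hc
  exact (htr hc).not_isRecurrentFrom 0 (h 0)

end Criteria

/-- The growth rate is E[Y_1], and the unit increments after `s` are i.i.d., hence stationary. -/
theorem IsLevyProcess.recurrent_iff_and_transient_iff {Ω : Type*} [MeasurableSpace Ω]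
    {P : Measure Ω} [IsProbabilityMeasure P] {Y : ℝ≥0 → Ω → ℝ} (hY : IsLevyProcess Y P)
    (h1 : Integrable (Y 1) P) :
    (IsRecurrentProcess Y P ↔ P[Y 1] = 0) ∧ (IsTransientProcess Y P ↔ P[Y 1] ≠ 0) := by
  have hlln := (hY.integral_eq_and_tendsto_div h1).2
  refine _root_.recurrent_iff_and_transient_iff hlln fun h0 s => ?_
  rw [h0] at hlln
  have hmono : Monotone fun n : ℕ => s + (n : ℝ≥0) * 1 := fun i j hij => by
    simp only; gcongr
  have hind := hY.indepIncrements.nat hmono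
  refine isRecurrentFrom_of_stationary (p := 1) one_pos
    (ξ := fun n ω => Y (s + (n + 1 : ℕ) * 1) ω - Y (s + n * 1) ω)
    (fun i => hY.measurable_sub _ _) (fun k => ?_) (Eventually.of_forall fun ω j => rfl) hlln
  refine iIndepFun.identDistrib_pi (fun i => hY.measurable_sub _ _)
    (fun i => hY.measurable_sub _ _) (hind.precomp (g := fun i => i + k)
      (fun i j hij => by simpa using hij)) hind fun i => ?_
  have := hY.stationaryIncrements (s + (i + k : ℕ) * 1) (s + i * 1) 1
  have hstep : ∀ m : ℕ, s + (m + 1 : ℕ) * (1 : ℝ≥0) = s + m * 1 + 1 := fun m => by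
    push_cast; ring
  rw [hstep, hstep]
  exact this

/-! ### Paths of the alternating construction -/

/-- The conditions satisfied by almost every path of an alternating process. -/
def IsAlternatingPath (p q : ℝ≥0) (y z x : ℝ≥0 → ℝ) : Prop :=
  x 0 = 0 ∧ ∀ (n : ℕ) (t : ℝ≥0),
    (n * p < t → t ≤ n * p + q → x t = x (n * p) + y t - y (n * p)) ∧
    (n * p + q < t → t ≤ (n + 1) * p → x t = x (n * p + q) + z t - z (n * p + q))

namespace IsAlternatingPath

variable {p q : ℝ≥0} {y z x : ℝ≥0 → ℝ}

/-- Clamping the time at the switch `n * p + q` lets one formula cover both phases of a period. -/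
theorem eq_add (hx : IsAlternatingPath p q y z x) (hq : 0 < q) (n : ℕ) {t : ℝ≥0}
    (hnt : n * p ≤ t) (htn : t ≤ (n + 1) * p) :
    x t = x (n * p) + (y (min t (n * p + q)) - y (n * p))
      + (z (max t (n * p + q)) - z (n * p + q)) := by
  have hlt : n * p < n * p + q := lt_add_of_pos_right _ hq
  rcases le_or_gt t (n * p + q) with h | h
  · rw [min_eq_left h, max_eq_right h, sub_self, add_zero]
    rcases hnt.eq_or_lt with rfl | h'
    · simp
    · rw [(hx.2 n t).1 h' h]; ring
  · rw [min_eq_right h.le, max_eq_left h.le, (hx.2 n t).2 h htn,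
      (hx.2 n (n * p + q)).1 hlt le_rfl]
    ring

theorem eq_add_of_le (hx : IsAlternatingPath p q y z x) (hq : 0 < q) (n : ℕ) {r : ℝ≥0}
    (hr : r ≤ p) :
    x (n * p + r) = x (n * p) + (y (n * p + min r q) - y (n * p))
      + (z (n * p + max q r) - z (n * p + q)) := by
  rw [hx.eq_add hq n le_self_add (by rw [add_mul, one_mul]; gcongr), min_add_add_left,
    max_add_add_left, max_comm q r]

theorem eq_add_period (hx : IsAlternatingPath p q y z x) (hq : 0 < q) (hqp : q ≤ p) (n : ℕ) :
    x ((n + 1 : ℕ) * p) = x (n * p) + (y (n * p + q) - y (n * p))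
      + (z ((n + 1 : ℕ) * p) - z (n * p + q)) := by
  have := hx.eq_add_of_le hq n (le_refl p)
  rw [min_eq_right hqp, max_eq_right hqp] at this
  rwa [Nat.cast_add, Nat.cast_one, add_mul, one_mul]

theorem eq_sum (hx : IsAlternatingPath p q y z x) (hq : 0 < q) (hqp : q ≤ p) (n : ℕ) :
    x (n * p) = ∑ k ∈ Finset.range n, (y (0 + k * p + q) - y (0 + k * p))
      + ∑ k ∈ Finset.range n, (z (q + k * p + (p - q)) - z (q + k * p)) := by
  induction n with
  | zero => simp [hx.1]
  | succ n ih =>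
    have h1 : q + n * p + (p - q) = (n + 1 : ℕ) * p := by
      rw [add_comm q, add_assoc, add_tsub_cancel_of_le hqp]
      push_cast
      ring
    rw [hx.eq_add_period hq hqp, ih, Finset.sum_range_succ, Finset.sum_range_succ, h1, zero_add,
      add_comm q]
    ring

/-- The increment over one period after time `np + r`, split over the periodic grids of `y`
and `z`. -/
theorem sub_eq_grid (hx : IsAlternatingPath p q y z x) (hq : 0 < q) (hqp : q ≤ p) {r : ℝ≥0}
    (hr : r ≤ p) (n : ℕ) :
    x ((n + 1 : ℕ) * p + r) - x (n * p + r) =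
      (y (periodicGrid p (min r q) q (3 * n + 1 + 1)) - y (periodicGrid p (min r q) q (3 * n + 1)))
      + (y (periodicGrid p (min r q) q (3 * n + 3 + 1))
        - y (periodicGrid p (min r q) q (3 * n + 3)))
      + (z (periodicGrid p q (max q r) (3 * n + 2 + 1))
        - z (periodicGrid p q (max q r) (3 * n + 2)))
      + (z (periodicGrid p q (max q r) (3 * n + 4 + 1))
        - z (periodicGrid p q (max q r) (3 * n + 4))) := by
  -- If `r ≤ q` the last increment of `z` is over an empty window; if `q ≤ r` the first increment of
  -- `y` is.
  rw [hx.eq_add_of_le hq (n + 1) hr, hx.eq_add_of_le hq n hr, hx.eq_add_period hq hqp,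
    show 3 * n + 1 + 1 = 3 * n + 2 by ring, show 3 * n + 4 + 1 = 3 * (n + 1) + 2 by ring,
    show 3 * n + 3 + 1 = 3 * (n + 1) + 1 by ring, show 3 * n + 2 + 1 = 3 * (n + 1) by ring]
  simp only [periodicGrid_three_mul, periodicGrid_three_mul_add_one,
    periodicGrid_three_mul_add_two]
  ring

/-- Since the last multiple of `p`, `x` has moved by increments of `y` and `z` inside one period;
these are o(t), as `y` and `z` have linear rates. -/
theorem tendsto_div (hx : IsAlternatingPath p q y z x) (hq : 0 < q) (hqp : q ≤ p) {a b m : ℝ}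
    (hy : Tendsto (fun t : ℝ≥0 => y t / t) atTop (𝓝 a))
    (hz : Tendsto (fun t : ℝ≥0 => z t / t) atTop (𝓝 b))
    (hxm : Tendsto (fun n : ℕ => x (n * p) / n) atTop (𝓝 m)) :
    Tendsto (fun t : ℝ≥0 => x t / t) atTop (𝓝 (m / p)) := by
  have hp : 0 < p := hq.trans_le hqp
  set N : ℝ≥0 → ℕ := fun t => ⌊t / p⌋₊ with hN
  have hfl : Tendsto N atTop atTop := NNReal.tendsto_natFloor_div_atTop hp
  have hdiv : Tendsto (fun t : ℝ≥0 => (N t : ℝ) / t) atTop (𝓝 (p : ℝ)⁻¹) :=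
    NNReal.tendsto_natFloor_div_div hp
  have hle : ∀ t, N t * p ≤ t := NNReal.natFloor_div_mul_le hp
  have hlt : ∀ t, t < (N t + 1) * p := NNReal.lt_natFloor_div_add_one_mul hp
  have hNp : Tendsto (fun t => (N t : ℝ≥0) * p) atTop atTop :=
    (tendsto_natCast_atTop_atTop.comp hfl).atTop_mul_const hp
  -- A time `σ t` in the same closed period as `t` satisfies `σ t / t → 1`, so it yields the same
  -- rate.
  have shift : ∀ {w : ℝ≥0 → ℝ} {c : ℝ}, Tendsto (fun t : ℝ≥0 => w t / t) atTop (𝓝 c) →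
      ∀ σ : ℝ≥0 → ℝ≥0, (∀ t, N t * p ≤ σ t) → (∀ t, σ t ≤ (N t + 1) * p) →
      Tendsto (fun t : ℝ≥0 => w (σ t) / t) atTop (𝓝 c) := by
    intro w c hw σ h1 h2
    have hσ : Tendsto σ atTop atTop := tendsto_atTop_mono h1 hNp
    have hinv : Tendsto (fun t : ℝ≥0 => (t : ℝ)⁻¹) atTop (𝓝 0) :=
      tendsto_inv_atTop_zero.comp (NNReal.tendsto_coe_atTop.2 tendsto_id)
    have hp' : (p : ℝ) ≠ 0 := by exact_mod_cast hp.ne'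
    have hlow : Tendsto (fun t : ℝ≥0 => (N t : ℝ) / t * p) atTop (𝓝 1) := by
      have := hdiv.mul_const (p : ℝ)
      rwa [inv_mul_cancel₀ hp'] at this
    have hup : Tendsto (fun t : ℝ≥0 => (N t : ℝ) / t * p + (t : ℝ)⁻¹ * p) atTop (𝓝 1) := by
      have := hlow.add (hinv.mul_const (p : ℝ))
      rwa [zero_mul, add_zero] at this
    have hratio : Tendsto (fun t : ℝ≥0 => (σ t : ℝ) / t) atTop (𝓝 1) := by
      refine tendsto_of_tendsto_of_tendsto_of_le_of_le hlow hup (fun t => ?_) (fun t => ?_)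
      · have h3 : (N t : ℝ) * p ≤ σ t := by exact_mod_cast h1 t
        calc (N t : ℝ) / t * p = N t * p / t := by ring
          _ ≤ σ t / t := by gcongr
      · have h3 : (σ t : ℝ) ≤ (N t + 1) * p := by exact_mod_cast h2 t
        calc (σ t : ℝ) / t ≤ (N t + 1) * p / t := by gcongr
          _ = N t / t * p + (t : ℝ)⁻¹ * p := by ring
    have h4 := (hw.comp hσ).mul hratio
    rw [mul_one] at h4
    refine h4.congr' ?_
    filter_upwards [hσ.eventually_gt_atTop 0] with t ht
    have ht' : (σ t : ℝ) ≠ 0 := by exact_mod_cast ht.ne'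
    simp only [Function.comp]
    field_simp
  have hqle : ∀ t, N t * p + q ≤ (N t + 1) * p := fun t => by
    rw [add_mul, one_mul]; gcongr
  have hy1 := shift hy (fun t => min t (N t * p + q)) (fun t => le_min (hle t) le_self_add)
    (fun t => (min_le_right _ _).trans (hqle t))
  have hy2 := shift hy (fun t => N t * p) (fun t => le_rfl)
    (fun t => le_self_add.trans (hqle t))
  have hz1 := shift hz (fun t => max t (N t * p + q)) (fun t => (hle t).trans (le_max_left _ _))
    (fun t => max_le (hlt t).le (hqle t))
  have hz2 := shift hz (fun t => N t * p + q) (fun t => le_self_add) hqle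
  have hx1 := (hxm.comp hfl).mul hdiv
  have hsum := (hx1.add (hy1.sub hy2)).add (hz1.sub hz2)
  rw [sub_self, sub_self, add_zero, add_zero, ← div_eq_mul_inv] at hsum
  refine hsum.congr' ?_
  filter_upwards [hfl.eventually_gt_atTop 0] with t ht
  have ht' : (N t : ℝ) ≠ 0 := by exact_mod_cast ht.ne'
  rw [hx.eq_add hq (N t) (hle t) (hlt t).le]
  simp only [Function.comp]
  field_simp

end IsAlternatingPath

/-! ### Growth and recurrence of the alternating process -/

theorem ProbabilityTheory.IdentDistrib.prodMk_of_indepFun {Ω α β : Type*} [MeasurableSpace Ω]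
    [MeasurableSpace α] [MeasurableSpace β] {P : Measure Ω} [IsFiniteMeasure P] {U U' : Ω → α}
    {V V' : Ω → β} (hU : IdentDistrib U U' P P) (hV : IdentDistrib V V' P P)
    (h : IndepFun U V P) (h' : IndepFun U' V' P) :
    IdentDistrib (fun ω => (U ω, V ω)) (fun ω => (U' ω, V' ω)) P P where
  aemeasurable_fst := hU.aemeasurable_fst.prodMk hV.aemeasurable_fst
  aemeasurable_snd := hU.aemeasurable_snd.prodMk hV.aemeasurable_snd
  map_eq := by
    rw [h.map_prod_eq_prod_map_map hU.aemeasurable_fst hV.aemeasurable_fst,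
      h'.map_prod_eq_prod_map_map hU.aemeasurable_snd hV.aemeasurable_snd, hU.map_eq, hV.map_eq]

section Alternating

variable {Ω : Type*} [MeasurableSpace Ω] {P : Measure Ω} [IsProbabilityMeasure P]
  {Y Z X : ℝ≥0 → Ω → ℝ} {p q : ℝ≥0}

/-- At multiples of `p` the path is a sum of Y-increments of length `q` and Z-increments of length
`p - q`, each obeying the strong law. -/
theorem IsAlternatingProcess.tendsto_div (hX : IsAlternatingProcess p q Y Z X P)
    (hY : IsLevyProcess Y P) (hZ : IsLevyProcess Z P) (hq : 0 < q) (hqp : q ≤ p)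
    (hY1 : Integrable (Y 1) P) (hZ1 : Integrable (Z 1) P) :
    ∀ᵐ ω ∂P, Tendsto (fun t : ℝ≥0 => X t ω / t) atTop
      (𝓝 ((P[Y q] + P[Z (p - q)]) / (p : ℝ))) := by
  filter_upwards [hX, (hY.integral_eq_and_tendsto_div hY1).2,
    (hZ.integral_eq_and_tendsto_div hZ1).2, hY.tendsto_sum_increments_div hY1 0 hqp,
    hZ.tendsto_sum_increments_div hZ1 q (tsub_le_self : p - q ≤ p)] with ω hω hy hz hys hzs
  have hpath : IsAlternatingPath p q (fun t => Y t ω) (fun t => Z t ω) (fun t => X t ω) := hω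
  refine hpath.tendsto_div hq hqp hy hz ((hys.add hzs).congr fun n => ?_)
  rw [hpath.eq_sum hq hqp, add_div]

/-- Increments over whole periods after `s` are a fixed function of the grid increments of Y and Z.
Shifting by whole periods preserves the law of each family, and by independence the joint law. -/
theorem IsAlternatingProcess.isRecurrentProcess (hX : IsAlternatingProcess p q Y Z X P)
    (hY : IsLevyProcess Y P) (hZ : IsLevyProcess Z P)
    (hYZ : IndepFun (fun ω t => Y t ω) (fun ω t => Z t ω) P) (hq : 0 < q) (hqp : q ≤ p)
    (hX0 : ∀ᵐ ω ∂P, Tendsto (fun t : ℝ≥0 => X t ω / t) atTop (𝓝 0)) :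
    IsRecurrentProcess X P := by
  intro s
  have hp : 0 < p := hq.trans_le hqp
  set n := ⌊s / p⌋₊ with hn
  obtain ⟨r, hr⟩ := exists_add_of_le (NNReal.natFloor_div_mul_le hp s)
  have hrp : r ≤ p := by
    have h1 := NNReal.lt_natFloor_div_add_one_mul hp s
    nth_rewrite 1 [hr] at h1
    rw [add_mul, one_mul] at h1
    exact (lt_of_add_lt_add_left h1).le
  set G := periodicGrid p (min r q) q with hG
  set H := periodicGrid p q (max q r) with hH
  -- increments over the grids, from the `k`-th period on
  set U : ℕ → Ω → ℕ → ℝ := fun k ω i => Y (G (i + 3 * k + 1)) ω - Y (G (i + 3 * k)) ω with hU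
  set V : ℕ → Ω → ℕ → ℝ := fun k ω i => Z (H (i + 3 * k + 1)) ω - Z (H (i + 3 * k)) ω with hV
  have hUV : ∀ k, IndepFun (U k) (V k) P := by
    intro k
    have hinc : ∀ T : ℕ → ℝ≥0,
        Measurable fun (f : ℝ≥0 → ℝ) (i : ℕ) => f (T (i + 3 * k + 1)) - f (T (i + 3 * k)) :=
      fun T => by fun_prop
    exact hYZ.comp (hinc G) (hinc H)
  have hUid : ∀ k l, IdentDistrib (U k) (U l) P P := fun k l =>
    (hY.identDistrib_increments (min_le_right r q) hqp k).trans
      (hY.identDistrib_increments (min_le_right r q) hqp l).symm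
  have hVid : ∀ k l, IdentDistrib (V k) (V l) P P := fun k l =>
    (hZ.identDistrib_increments (le_max_left q r) (max_le hqp hrp) k).trans
      (hZ.identDistrib_increments (le_max_left q r) (max_le hqp hrp) l).symm
  set F : (ℕ → ℝ) × (ℕ → ℝ) → ℕ → ℝ := fun d j =>
    d.1 (3 * j + 1) + d.1 (3 * j + 3) + d.2 (3 * j + 2) + d.2 (3 * j + 4) with hF
  have hFm : Measurable F := measurable_pi_lambda _ fun j => by
    simp only [hF]; fun_prop
  -- Built from Y and Z, `ξ` is measurable, whereas X is not assumed to be; it agrees a.s. with the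
  -- increments of X.
  set ξ : ℕ → Ω → ℝ := fun j ω => F (U n ω, V n ω) j with hξ
  have hξshift : ∀ k, (fun ω i => ξ (i + k) ω) = F ∘ fun ω => (U (n + k) ω, V (n + k) ω) := by
    intro k
    ext ω i
    have e : ∀ c, 3 * (i + k) + c + 3 * n = 3 * i + c + 3 * (n + k) := fun c => by ring
    simp only [hξ, hF, hU, hV, Function.comp, e]
  refine isRecurrentFrom_of_stationary hp (ξ := ξ) (fun j => ?_) (fun k => ?_) ?_ hX0
  · have h1 : ∀ i, Measurable fun ω => U n ω i := fun i => hY.measurable_sub _ _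
    have h2 : ∀ i, Measurable fun ω => V n ω i := fun i => hZ.measurable_sub _ _
    exact (((h1 _).add (h1 _)).add (h2 _)).add (h2 _)
  · rw [hξshift k]
    exact ((hUid (n + k) n).prodMk_of_indepFun (hVid (n + k) n) (hUV _) (hUV _)).comp hFm
  · filter_upwards [hX] with ω hω j
    have hpath : IsAlternatingPath p q (fun t => Y t ω) (fun t => Z t ω) (fun t => X t ω) := hω
    have h1 := hpath.sub_eq_grid hq hqp hrp (n + j)
    have h2 : ∀ k : ℕ, s + k * p = (n + k : ℕ) * p + r := fun k => by
      rw [hr]; push_cast; ring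
    rw [h2, h2, ← add_assoc n j 1]
    refine h1.trans ?_
    have e : ∀ c, 3 * j + c + 3 * n = 3 * (n + j) + c := fun c => by ring
    simp only [hξ, hF, hU, hV, hG, hH, e]

end Alternating

theorem corollary4p3 {Ω : Type*} [MeasurableSpace Ω] (P : Measure Ω) [IsProbabilityMeasure P]
    (Y Z X : ℝ≥0 → Ω → ℝ) (hY : IsLevyProcess Y P) (hZ : IsLevyProcess Z P)
    (hYZ : IndepFun (fun ω t => Y t ω) (fun ω t => Z t ω) P)
    (p q : ℝ≥0) (hq : 0 < q) (hqp : q < p)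
    (hX : IsAlternatingProcess p q Y Z X P)
    (hY1 : Integrable (Y 1) P) (hZ1 : Integrable (Z 1) P) :
    -- the expectations below are well defined
    (Integrable (Y q) P ∧ Integrable (Z (p - q)) P) ∧
    -- (i)
    ((IsRecurrentProcess Y P ∧ IsRecurrentProcess Z P ↔ P[Y 1] = 0 ∧ P[Z 1] = 0) ∧
      (P[Y 1] = 0 ∧ P[Z 1] = 0 → P[Y q + Z (p - q)] = 0) ∧
      (P[Y q + Z (p - q)] = 0 ↔ IsRecurrentProcess X P)) ∧
    -- (ii)
    ((IsRecurrentProcess Y P ∧ IsTransientProcess Z P ↔ P[Y 1] = 0 ∧ P[Z 1] ≠ 0) ∧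
      (P[Y 1] = 0 ∧ P[Z 1] ≠ 0 → P[Y q + Z (p - q)] ≠ 0) ∧
      (P[Y q + Z (p - q)] ≠ 0 ↔ IsTransientProcess X P)) ∧
    -- (iii)
    (IsTransientProcess Y P ∧ IsTransientProcess Z P →
      (IsRecurrentProcess X P ↔ P[Y q] = -P[Z (p - q)]) ∧
      (IsTransientProcess X P ↔ P[Y q] ≠ -P[Z (p - q)])) := by
  have hYq := hY.integrable hY1 q
  have hZq := hZ.integrable hZ1 (p - q)
  have hp : (p : ℝ) ≠ 0 := by exact_mod_cast (hq.trans hqp).ne'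
  have hsum : P[Y q + Z (p - q)] = P[Y q] + P[Z (p - q)] := integral_add' hYq hZq
  have hYm := (hY.integral_eq_and_tendsto_div hY1).1 q
  have hZm := (hZ.integral_eq_and_tendsto_div hZ1).1 (p - q)
  -- Strictness of `q < p` matters here: in (ii) the drift per period is (p - q) E[Z_1].
  have hpq : ((p - q : ℝ≥0) : ℝ) ≠ 0 := by exact_mod_cast (tsub_pos_of_lt hqp).ne'
  have hXt := hX.tendsto_div hY hZ hq hqp.le hY1 hZ1
  obtain ⟨hYrec, hYtr⟩ := hY.recurrent_iff_and_transient_iff hY1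
  obtain ⟨hZrec, hZtr⟩ := hZ.recurrent_iff_and_transient_iff hZ1
  obtain ⟨hXrec, hXtr⟩ := recurrent_iff_and_transient_iff hXt fun h0 => by
    rw [h0] at hXt
    exact hX.isRecurrentProcess hY hZ hYZ hq hqp.le hXt
  have hdiv : (P[Y q] + P[Z (p - q)]) / (p : ℝ) = 0 ↔ P[Y q] + P[Z (p - q)] = 0 := by
    simp [hp]
  rw [Ne, hdiv] at hXtr
  rw [hdiv] at hXrec
  refine ⟨⟨hYq, hZq⟩, ⟨and_congr hYrec hZrec, ?_, ?_⟩, ⟨and_congr hYrec hZtr, ?_, ?_⟩, fun _ => ?_⟩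
  · rintro ⟨ha, hb⟩
    rw [hsum, hYm, hZm, ha, hb]
    simp
  · rw [hsum, hXrec]
  · rintro ⟨ha, hb⟩
    rw [hsum, hYm, hZm, ha, mul_zero, zero_add]
    exact mul_ne_zero hpq hb
  · rw [hsum, hXtr]
  · rw [hXrec, hXtr, Ne, eq_neg_iff_add_eq_zero]
    exact ⟨Iff.rfl, Iff.rfl⟩
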